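/- Let $\mathbb S^2\subset\mathbb R^3$ be the unit sphere with its canonical surface measure, let $\Delta$ be its Laplace--Beltrami operator, fix a real number $k>1$ and put $A=-\Delta+k$. Let $\mathcal E=C^\infty(\mathbb S^2)$ be the space of smooth real-valued functions on $\mathbb S^2$ with the (nuclear Fréchet) projective limit topology defined by the norms $\|\psi\|_p=\|A^p\psi\|_{L^2(\mathbb S^2)}$, $p=0,1,2,\dots$. Let $\mathcal E'$ be its topological dual, i.e. the space of continuous linear functionals $\mathcal E\to\mathbb R$, with the pairing $(\beta,\alpha)=\beta(\alpha)$ and with the cylinder $\sigma$-algebra, i.e. the smallest $\sigma$-algebra that makes all the maps $\beta\mapsto(\beta,\alpha)$, $\alpha\in\mathcal E$, measurable. Then $$\varphi(\alpha)=e^{-\frac12\|\alpha\|_{L^2(\mathbb S^2)}^2},\qquad \alpha\in\mathcal E,$$ is the characteristic function of a unique probability measure on $\mathcal E'$: there is exactly one probability measure $\nu'$ on $\mathcal E'$ such that $$\int_{\mathcal E'}e^{i(\beta,\alpha)}\,d\nu'(\beta)=e^{-\frac12\|\alpha\|_{L^2(\mathbb S^2)}^2}\qquad\text{for all }\alpha\in\mathcal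 E.$$ -/

import Mathlib

open scoped Manifold ContDiff
open MeasureTheory

noncomputable section

namespace BMS

/-- Euclidean three-space. -/
abbrev E3 : Type := EuclideanSpace ℝ (Fin 3)

instance : Fact (Module.finrank ℝ E3 = 2 + 1) := ⟨by simp⟩

/-- The unit two-sphere in Euclidean three-space. -/
abbrev S2 : Type := Metric.sphere (0 : E3) 1

/-- The canonical (surface) measure on the unit two-sphere. -/
def sphereMeasure : Measure S2 := (volume : Measure E3).toSphere

instance : IsFiniteMeasure sphereMeasure := by
  unfold sphereMeasure; infer_instance

/-- The real vector space of smooth real-valued functions on the sphere. -/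
abbrev SmoothFun : Type := C^∞⟮𝓡 2, S2; 𝓘(ℝ, ℝ), ℝ⟯

/-- A smooth function, as a continuous function. -/
def toContinuous : SmoothFun →ₗ[ℝ] C(S2, ℝ) where
  toFun f := ⟨f, f.contMDiff.continuous⟩
  map_add' _ _ := rfl
  map_smul' _ _ := rfl

/-- The embedding of smooth functions into the real Hilbert space `L²(S²)`. -/
def toL2 : SmoothFun →ₗ[ℝ] Lp ℝ 2 sphereMeasure :=
  (ContinuousMap.toLp (E := ℝ) 2 sphereMeasure ℝ).toLinearMap.comp toContinuous

/-- The radial projection `y ↦ y / ‖y‖` onto the sphere (with an arbitrary value at `0`). -/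
def radialProj (y : E3) : S2 :=
  if h : y = 0 then ⟨EuclideanSpace.single 0 1, by simp⟩
  else ⟨‖y‖⁻¹ • y, by simp [norm_smul, h]⟩

/-- The extension of a function on the sphere to a function on `ℝ³` which, away from the origin,
is constant on the rays issuing from the origin. -/
def radialExt (f : S2 → ℝ) : E3 → ℝ := fun y => f (radialProj y)

/-- The Laplace–Beltrami operator of the round sphere: the Euclidean Laplacian of the radially
constant extension, restricted to the sphere. -/
def sphereLaplacianFun (f : S2 → ℝ) : S2 → ℝ :=
  fun x => Laplacian.laplacian (radialExt f) (x : E3)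

theorem two_le_infty : (2 : WithTop ℕ∞) ≤ ∞ := by
  exact WithTop.coe_le_coe.2 (le_top (a := (2 : ℕ∞)))

theorem radialProj_coe {y : E3} (h : y ≠ 0) : (radialProj y : E3) = ‖y‖⁻¹ • y := by
  simp [radialProj, h]

theorem coe_ne_zero (x : S2) : (x : E3) ≠ 0 := by
  intro h
  have := x.2
  simp [h] at this

theorem contDiffAt_radialExt (f : SmoothFun) {y : E3} (hy : y ≠ 0) :
    ContDiffAt ℝ ∞ (radialExt f) y := by
  let U : TopologicalSpace.Opens E3 := ⟨{0}ᶜ, isOpen_compl_singleton⟩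
  have h1 : ContMDiff 𝓘(ℝ, E3) 𝓘(ℝ, E3) ∞ (fun z : U => ‖(z : E3)‖⁻¹ • (z : E3)) := by
    intro z
    have hz : (z : E3) ≠ 0 := z.2
    have : ContDiffAt ℝ ∞ (fun w : E3 => ‖w‖⁻¹ • w) z :=
      ((contDiffAt_norm ℝ hz).inv (norm_ne_zero_iff.2 hz)).smul contDiffAt_id
    exact contMDiffAt_subtype_iff.2 this.contMDiffAt
  have h2 : ∀ z : U, ‖(z : E3)‖⁻¹ • (z : E3) ∈ Metric.sphere (0 : E3) 1 := by
    intro z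
    have hz : (z : E3) ≠ 0 := z.2
    simp [norm_smul, hz]
  have h3 := h1.codRestrict_sphere (n := 2) h2
  have h4 : ContMDiff 𝓘(ℝ, E3) 𝓘(ℝ, ℝ) ∞ (fun z : U => radialExt f (z : E3)) := by
    have h5 := f.contMDiff.comp h3
    refine h5.congr ?_
    intro z
    have hz : (z : E3) ≠ 0 := z.2
    simp only [radialExt, Function.comp]
    congr 1
    apply Subtype.ext
    rw [radialProj_coe hz]
    rfl
  have h6 := h4 ⟨y, hy⟩
  exact (contMDiffAt_subtype_iff.1 h6).contDiffAt

theorem contDiffAt_laplacian {g : E3 → ℝ} {y : E3} (hg : ContDiffAt ℝ ∞ g y) :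
    ContDiffAt ℝ ∞ (Laplacian.laplacian g) y := by
  rw [InnerProductSpace.laplacian_eq_iteratedFDeriv_stdOrthonormalBasis]
  refine ContDiffAt.sum fun i _ => ?_
  have h := hg.iteratedFDeriv_right (i := 2) (m := ∞) le_rfl
  exact (ContinuousMultilinearMap.apply ℝ (fun _ : Fin 2 => E3) ℝ _).contDiff.contDiffAt.comp y h

/-- The Laplace–Beltrami operator as a linear operator on smooth functions on the sphere. -/
def sphereLaplacian : SmoothFun →ₗ[ℝ] SmoothFun where
  toFun f := ⟨sphereLaplacianFun f, by
    intro x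
    exact (contDiffAt_laplacian
      (contDiffAt_radialExt f (coe_ne_zero x))).contMDiffAt.comp x (contMDiff_coe_sphere x)⟩
  map_add' f g := by
    ext x
    exact ((contDiffAt_radialExt f (coe_ne_zero x)).of_le two_le_infty).laplacian_add
      ((contDiffAt_radialExt g (coe_ne_zero x)).of_le two_le_infty)
  map_smul' c f := by
    ext x
    exact InnerProductSpace.laplacian_smul c
      ((contDiffAt_radialExt f (coe_ne_zero x)).of_le two_le_infty)

/-- The operator `A = -Δ + k`, whose eigenvalue on the spherical harmonics of degree `l`
is `l (l + 1) + k`. -/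
def opA (k : ℝ) : SmoothFun →ₗ[ℝ] SmoothFun := -sphereLaplacian + k • LinearMap.id

/-- The space `C^∞(S²)`, to be equipped with the projective limit topology defined by the norms
`‖A ^ p ψ‖` of `L²(S²)`, where `A = -Δ + k`. -/
def TestSpace (_k : ℝ) : Type := SmoothFun

instance (k : ℝ) : AddCommGroup (TestSpace k) := inferInstanceAs (AddCommGroup SmoothFun)

instance (k : ℝ) : Module ℝ (TestSpace k) := inferInstanceAs (Module ℝ SmoothFun)

/-- The inclusion of the test space into `L²(S²)`. -/
def TestSpace.toL2 (k : ℝ) : TestSpace k →ₗ[ℝ] Lp ℝ 2 sphereMeasure := BMS.toL2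

/-- The norms `ψ ↦ ‖A ^ p ψ‖` of `L²(S²)`. -/
def sobolevNorm (k : ℝ) : SeminormFamily ℝ (TestSpace k) ℕ := fun p =>
  (normSeminorm ℝ (Lp ℝ 2 sphereMeasure)).comp
    ((BMS.toL2.comp (opA k ^ p) : SmoothFun →ₗ[ℝ] Lp ℝ 2 sphereMeasure) :
      TestSpace k →ₗ[ℝ] Lp ℝ 2 sphereMeasure)

/-- The projective limit topology. -/
instance (k : ℝ) : TopologicalSpace (TestSpace k) := (sobolevNorm k).moduleFilterBasis.topology

theorem withSeminorms_sobolevNorm (k : ℝ) : WithSeminorms (sobolevNorm k) := ⟨rfl⟩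

instance (k : ℝ) : IsTopologicalAddGroup (TestSpace k) :=
  (withSeminorms_sobolevNorm k).topologicalAddGroup

instance (k : ℝ) : ContinuousSMul ℝ (TestSpace k) :=
  (withSeminorms_sobolevNorm k).continuousSMul

/-- The space of real distributions on the sphere: the topological dual of the test space. -/
def Distributions (k : ℝ) : Type := TestSpace k →L[ℝ] ℝ

/-- The natural pairing of distributions with test functions. -/
def pairing {k : ℝ} (β : Distributions k) (α : TestSpace k) : ℝ :=
  (show TestSpace k →L[ℝ] ℝ from β) α

/-- The cylinder `σ`-algebra: the smallest one for which all the evaluations `β ↦ (β, α)`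
are measurable. -/
instance (k : ℝ) : MeasurableSpace (Distributions k) :=
  ⨆ α : TestSpace k, MeasurableSpace.comap (fun β : Distributions k => pairing β α) (borel ℝ)

/-- `IsCharFun ν φ` says that `φ` is the characteristic function of the measure `ν`:
`φ α = ∫ exp (i (β, α)) dν(β)` for all test functions `α`. -/
def IsCharFun {k : ℝ} (ν : Measure (Distributions k)) (φ : TestSpace k → ℂ) : Prop :=
  ∀ α : TestSpace k, φ α = ∫ β, Complex.exp (Complex.I * (pairing β α : ℂ)) ∂ν

/-- The Gaussian functional `α ↦ exp (-‖α‖² / 2)` of the norm of `L²(S²)`. -/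
def gaussianFunctional (k : ℝ) : TestSpace k → ℂ := fun α =>
  Complex.exp (-(1 / 2 : ℂ) * ((‖TestSpace.toL2 k α‖ ^ 2 : ℝ) : ℂ))

end BMS

end

/-! Uniqueness: the characteristic function evaluated at linear combinations of test functions
determines all finite-dimensional marginals, and these determine a measure on the cylinder
σ-algebra.

Existence: an explicit random distribution is built. Let `L α = (α, A α)`, with values in `L² × L²`;
it is continuous because its norm is controlled by the norms `p = 0, 1`. The analytic input is the
bound `|α x| ≤ C ‖L α‖` (`exists_abs_le_norm_graphMap`). If the `L αₙ` are orthonormal or zero, this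
bound applied to the test function `∑ αₙ(x) αₙ` gives `∑ αₙ(x)² ≤ C²`. Integrating over the sphere
bounds `∑ ‖αₙ‖²`: the inclusion into `L²` is Hilbert–Schmidt relative to the graph norm. No spectral
theory of `A` is needed.

Take such a sequence whose Fourier sums recover the range of `L`, and centred Gaussian variables
`ηₙ` with the covariance of the `αₙ` in `L²`. Then `∑ ηₙ²` has finite mean, so `X = ∑ ηₙ L αₙ`
converges almost surely, and `α ↦ ⟪X, L α⟫` is a random distribution. Its characteristic function is
a limit of Gaussian ones, whose variances tend to `‖α‖²` (`exists_gaussian_vector`).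

The pointwise bound comes from the Fourier proof of `H² ⊆ C⁰` in `ℝ³`, applied to the cut off radial
extension of `α`; polar coordinates bring the norms back to the sphere. -/

namespace BMS
open scoped FourierTransform SchwartzMap Laplacian

/-! ### Sobolev inequality for Schwartz functions. -/

theorem one_add_norm_sq_smul_fourier {E : Type*} [NormedAddCommGroup E] [InnerProductSpace ℝ E]
    [FiniteDimensional ℝ E] [MeasurableSpace E] [BorelSpace E] (f : 𝓢(E, ℂ)) (ξ : E) :
    (𝓕 (f - Δ f) : 𝓢(E, ℂ)) ξ = ((1 + (2 * Real.pi) ^ 2 * ‖ξ‖ ^ 2 : ℝ) : ℂ) * (𝓕 f : 𝓢(E, ℂ)) ξ := by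
  have hg : (fun x : E => ‖x‖ ^ 2).HasTemperateGrowth := by fun_prop
  have h : 𝓕 (f - Δ f) = 𝓕 f - 𝓕 (Δ f) := (SchwartzMap.fourierTransformCLM ℂ).map_sub f (Δ f)
  have h2 : 𝓕 (Δ f) = (-(2 * Real.pi) ^ 2) • SchwartzMap.smulLeftCLM ℂ (fun x : E => ‖x‖ ^ 2) (𝓕 f) := by
    rw [SchwartzMap.laplacian_eq_fourierMultiplierCLM, SchwartzMap.fourierMultiplierCLM_apply]
    have := ((SchwartzMap.fourierTransformCLM ℂ).restrictScalars ℝ).map_smul (-(2 * Real.pi) ^ 2)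
      (𝓕⁻ (SchwartzMap.smulLeftCLM ℂ (fun x : E => ‖x‖ ^ 2) (𝓕 f)))
    refine this.trans ?_
    congr 1
    exact FourierTransform.fourier_fourierInv_eq (F := 𝓢(E, ℂ)) _
  rw [h, h2, sub_apply, smul_apply, SchwartzMap.smulLeftCLM_apply_apply hg]
  simp only [Complex.real_smul]
  push_cast
  ring

/-- The square `(1 + ‖x‖²)⁻²` decays like `‖x‖⁻⁴`, hence is integrable below dimension four; the
restriction on the dimension enters only here. -/
theorem memLp_inv_one_add_norm_sq {E : Type*} [NormedAddCommGroup E] [InnerProductSpace ℝ E]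
    [FiniteDimensional ℝ E] [MeasurableSpace E] [BorelSpace E] (hE : Module.finrank ℝ E < 4) :
    MemLp (fun x : E => (1 + ‖x‖ ^ 2)⁻¹) 2 := by
  have hc : Continuous (fun x : E => (1 + ‖x‖ ^ 2)⁻¹) :=
    Continuous.inv₀ (by fun_prop) fun x => by positivity
  rw [memLp_two_iff_integrable_sq hc.aestronglyMeasurable]
  have h := integrable_rpow_neg_one_add_norm_sq (E := E) (μ := volume) (r := 4)
    (by exact_mod_cast hE)
  refine h.congr (Filter.Eventually.of_forall fun x => ?_)
  have : (-4 / 2 : ℝ) = -((2 : ℕ) : ℝ) := by norm_num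
  simp only [this]
  rw [Real.rpow_neg (by positivity), Real.rpow_natCast, inv_pow]

/-- Fourier inversion writes `f x` as the Fourier transform of `𝓕 f` at `-x`, which is bounded by an
`L¹` norm. -/
theorem norm_apply_le_norm_fourier_toLp_one {E : Type*} [NormedAddCommGroup E]
    [InnerProductSpace ℝ E] [FiniteDimensional ℝ E] [MeasurableSpace E] [BorelSpace E]
    (f : 𝓢(E, ℂ)) (x : E) : ‖f x‖ ≤ ‖(𝓕 f : 𝓢(E, ℂ)).toLp 1 volume‖ := by
  have h : 𝓕⁻ (𝓕 f) = f := FourierTransform.fourierInv_fourier_eq f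
  have h' : f x = (𝓕 (𝓕 f : 𝓢(E, ℂ)) : 𝓢(E, ℂ)) (-x) := by
    conv_lhs => rw [← h]
    rw [SchwartzMap.fourierInv_coe, Real.fourierInv_eq_fourier_neg]
    rfl
  rw [h']
  exact SchwartzMap.norm_fourier_apply_le_toLp_one _ _

theorem norm_fourier_le {E : Type*} [NormedAddCommGroup E]
    [InnerProductSpace ℝ E] [FiniteDimensional ℝ E] [MeasurableSpace E] [BorelSpace E]
    (f : 𝓢(E, ℂ)) (ξ : E) :
    ‖(𝓕 f : 𝓢(E, ℂ)) ξ‖ ≤ ‖(1 + ‖ξ‖ ^ 2)⁻¹ • (𝓕 (f - Δ f) : 𝓢(E, ℂ)) ξ‖ := by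
  rw [one_add_norm_sq_smul_fourier, norm_smul, norm_mul, Complex.norm_real, ← mul_assoc]
  refine le_mul_of_one_le_left (norm_nonneg _) ?_
  have h3 : (1 : ℝ) ≤ (2 * Real.pi) ^ 2 := by nlinarith [Real.pi_gt_three]
  rw [Real.norm_of_nonneg (by positivity), Real.norm_of_nonneg (by positivity),
    inv_mul_eq_div, one_le_div (by positivity)]
  nlinarith [sq_nonneg ‖ξ‖]

/-- The Sobolev embedding `H² ⊆ C⁰` in dimension at most three, for Schwartz functions. -/
theorem exists_norm_le_eLpNorm_sub_laplacian {E : Type*} [NormedAddCommGroup E]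
    [InnerProductSpace ℝ E] [FiniteDimensional ℝ E] [MeasurableSpace E] [BorelSpace E]
    (hE : Module.finrank ℝ E < 4) :
    ∃ C : ℝ, 0 ≤ C ∧ ∀ (f : 𝓢(E, ℂ)) (x : E),
      ‖f x‖ ≤ C * (eLpNorm (⇑(f - Δ f)) 2 volume).toReal := by
  have hw := memLp_inv_one_add_norm_sq hE
  refine ⟨(eLpNorm (fun x : E => (1 + ‖x‖ ^ 2)⁻¹) 2 volume).toReal, ENNReal.toReal_nonneg,
    fun f x => (norm_apply_le_norm_fourier_toLp_one f x).trans ?_⟩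
  have h1 := norm_fourier_le f
  have hg : MemLp (⇑(𝓕 (f - Δ f) : 𝓢(E, ℂ))) 2 volume := SchwartzMap.memLp _ 2 volume
  -- Plancherel for `f - Δ f`.
  have h2 : (eLpNorm (⇑(f - Δ f)) 2 volume).toReal
      = (eLpNorm (⇑(𝓕 (f - Δ f) : 𝓢(E, ℂ))) 2 volume).toReal := by
    have := SchwartzMap.norm_fourier_toL2_eq (f - Δ f)
    rw [SchwartzMap.norm_toLp, SchwartzMap.norm_toLp] at this
    exact this.symm
  rw [h2, SchwartzMap.norm_toLp, ← ENNReal.toReal_mul]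
  refine ENNReal.toReal_mono (ENNReal.mul_ne_top hw.2.ne hg.2.ne) ?_
  generalize (𝓕 (f - Δ f) : 𝓢(E, ℂ)) = g at hg h1
  -- Hölder with `1/2 + 1/2 = 1`: the `L¹` norm of `𝓕 f` is split into the weight and the transform
  -- of `f - Δ f`.
  have h3 := eLpNorm_smul_le_mul_eLpNorm (p := 2) (q := 2) (r := 1) hg.1 hw.1
  exact (eLpNorm_mono h1).trans h3

end BMS

namespace BMS
open scoped Laplacian

/-! ### Laplacians of products and of radially constant functions. -/

section Laplacian
variable {E : Type*} [NormedAddCommGroup E] [InnerProductSpace ℝ E] [FiniteDimensional ℝ E]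

theorem laplacian_eq_sum_fderiv_fderiv {F : Type*} [NormedAddCommGroup F] [NormedSpace ℝ F]
    (g : E → F) (y : E) :
    Δ g y = ∑ i, fderiv ℝ (fderiv ℝ g) y (stdOrthonormalBasis ℝ E i)
      (stdOrthonormalBasis ℝ E i) := by
  rw [InnerProductSpace.laplacian_eq_iteratedFDeriv_stdOrthonormalBasis]
  simp [iteratedFDeriv_two_apply]

theorem laplacian_mul {f g : E → ℝ} {y : E} (hf : ContDiffAt ℝ 2 f y) (hg : ContDiffAt ℝ 2 g y) :
    Δ (fun z => f z * g z) y = f y * Δ g y + g y * Δ f y +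
      2 * ∑ i, fderiv ℝ f y (stdOrthonormalBasis ℝ E i) *
        fderiv ℝ g y (stdOrthonormalBasis ℝ E i) := by
  have h1 : fderiv ℝ (fun z => f z * g z) =ᶠ[nhds y]
      fun z => f z • fderiv ℝ g z + g z • fderiv ℝ f z := by
    filter_upwards [hf.eventually (by simp), hg.eventually (by simp)] with z hfz hgz
    exact fderiv_fun_mul (hfz.differentiableAt (by simp)) (hgz.differentiableAt (by simp))
  have hf1 : DifferentiableAt ℝ f y := hf.differentiableAt (by simp)
  have hg1 : DifferentiableAt ℝ g y := hg.differentiableAt (by simp)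
  have hf2 : DifferentiableAt ℝ (fderiv ℝ f) y :=
    (hf.fderiv_right (m := 1) (by norm_num)).differentiableAt (by simp)
  have hg2 : DifferentiableAt ℝ (fderiv ℝ g) y :=
    (hg.fderiv_right (m := 1) (by norm_num)).differentiableAt (by simp)
  simp only [laplacian_eq_sum_fderiv_fderiv]
  rw [h1.fderiv_eq, fderiv_fun_add (hf1.fun_smul hg2) (hg1.fun_smul hf2), fderiv_fun_smul hf1 hg2,
    fderiv_fun_smul hg1 hf2]
  simp only [Finset.mul_sum, ← Finset.sum_add_distrib]
  refine Finset.sum_congr rfl fun i _ => ?_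
  simp
  ring

/-- Differentiating `g (c • z) = g z` twice produces one factor `c` each time. -/
theorem laplacian_smul_of_comp_smul_eq {F : Type*} [NormedAddCommGroup F] [NormedSpace ℝ F]
    {g : E → F} {c : ℝ} (h : ∀ z, g (c • z) = g z) (y : E) :
    c ^ 2 • Δ g (c • y) = Δ g y := by
  have h1 : fderiv ℝ g = fun z => c • fderiv ℝ g (c • z) := by
    ext1 z
    rw [← fderiv_comp_smul]
    simp only [h]
  have h2 : fderiv ℝ (fderiv ℝ g) y = c • c • fderiv ℝ (fderiv ℝ g) (c • y) := by
    conv_lhs => rw [h1]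
    rw [← fderiv_comp_smul]
    exact congrFun (fderiv_const_smul_field (𝕜 := ℝ) (f := fun z => fderiv ℝ g (c • z)) c) y
  simp only [laplacian_eq_sum_fderiv_fderiv]
  rw [h2]
  simp [Finset.smul_sum, pow_two, mul_smul]

theorem sum_inner_mul_fderiv_apply (L : E →L[ℝ] ℝ) (y : E) :
    ∑ i, inner ℝ y (stdOrthonormalBasis ℝ E i) * L (stdOrthonormalBasis ℝ E i) = L y := by
  conv_rhs => rw [← (stdOrthonormalBasis ℝ E).sum_repr y]
  simp only [map_sum, map_smul, smul_eq_mul, OrthonormalBasis.repr_apply_apply]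
  exact Finset.sum_congr rfl fun i _ => by rw [real_inner_comm]

end Laplacian

theorem radialProj_smul {c : ℝ} (hc : 0 < c) (y : E3) : radialProj (c • y) = radialProj y := by
  by_cases hy : y = 0
  · simp [hy]
  apply Subtype.ext
  rw [radialProj_coe (smul_ne_zero hc.ne' hy), radialProj_coe hy, norm_smul, smul_smul,
    Real.norm_of_nonneg hc.le]
  congr 1
  field_simp

theorem radialProj_coe_sphere (x : S2) : radialProj (x : E3) = x := by
  apply Subtype.ext
  rw [radialProj_coe (coe_ne_zero x)]
  simp

theorem fderiv_radialExt_self (α : SmoothFun) {y : E3} (hy : y ≠ 0) :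
    fderiv ℝ (radialExt α) y y = 0 := by
  have h1 : HasFDerivAt (radialExt α) (fderiv ℝ (radialExt α) y) ((1 : ℝ) • y) := by
    rw [one_smul]
    exact ((contDiffAt_radialExt α hy).differentiableAt (by simp)).hasFDerivAt
  have h2 : HasDerivAt (fun t : ℝ => t • y) y 1 := by
    simpa using (hasDerivAt_id (1 : ℝ)).smul_const y
  have h3 := h1.comp_hasDerivAt (1 : ℝ) h2
  refine h3.unique ((hasDerivAt_const (1 : ℝ) (radialExt α y)).congr_of_eventuallyEq ?_)
  filter_upwards [lt_mem_nhds (zero_lt_one' ℝ)] with t ht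
  simp [radialExt, radialProj_smul ht]

/-- Scaling by `c = ‖y‖⁻¹` moves `y` to the sphere, where the Laplacian of the extension is
`sphereLaplacian` by definition. -/
theorem laplacian_radialExt (α : SmoothFun) {y : E3} (hy : y ≠ 0) :
    Δ (radialExt α) y = (‖y‖ ^ 2)⁻¹ * sphereLaplacian α (radialProj y) := by
  have h := laplacian_smul_of_comp_smul_eq (g := radialExt α) (c := ‖y‖⁻¹)
    (fun z => by simp [radialExt, radialProj_smul (inv_pos.2 (norm_pos_iff.2 hy))]) y
  rw [← h, ← radialProj_coe hy, smul_eq_mul, inv_pow]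
  rfl

/-- A bump around `1` is composed with `‖y‖²` rather than `‖y‖`: this is smooth at the origin too,
and its gradient is a multiple of `y`. -/
theorem exists_radial_cutoff : ∃ φ : E3 → ℝ, ContDiff ℝ ∞ φ ∧
    tsupport φ ⊆ {y | 1 / 2 ≤ ‖y‖ ^ 2 ∧ ‖y‖ ^ 2 ≤ 3 / 2} ∧ (∀ y, 0 ≤ φ y) ∧ (∀ y, φ y ≤ 1) ∧
    (∀ x : S2, φ x = 1) ∧ ∀ y, ∃ c : ℝ, ∀ v, fderiv ℝ φ y v = c * inner ℝ y v := by
  let b : ContDiffBump (1 : ℝ) := ⟨1 / 4, 1 / 2, by norm_num, by norm_num⟩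
  have hb : ContDiff ℝ ∞ b := b.contDiff
  refine ⟨fun y => b (‖y‖ ^ 2), hb.comp (contDiff_norm_sq ℝ), ?_, fun y => b.nonneg,
    fun y => b.le_one, fun x => ?_, fun y => ⟨deriv b (‖y‖ ^ 2) * 2, fun v => ?_⟩⟩
  · refine closure_minimal (fun y hy => ?_) ?_
    · have h : ‖y‖ ^ 2 ∈ Function.support b := hy
      rw [b.support_eq, Metric.mem_ball, Real.dist_eq, abs_lt] at h
      have h1 := h.1
      have h2 := h.2
      rw [show b.rOut = 1 / 2 from rfl] at h1 h2
      exact ⟨by linarith, by linarith⟩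
    · have h : Continuous fun y : E3 => ‖y‖ ^ 2 := by fun_prop
      exact (isClosed_le continuous_const h).inter (isClosed_le h continuous_const)
  · refine b.one_of_mem_closedBall ?_
    simp only [norm_eq_of_mem_sphere, one_pow]
    exact Metric.mem_closedBall_self b.rIn_pos.le
  · have h1 : HasDerivAt b (deriv b (‖y‖ ^ 2)) (‖y‖ ^ 2) :=
      (hb.differentiable (by simp)).differentiableAt.hasDerivAt
    have h2 := h1.comp_hasFDerivAt y (hasStrictFDerivAt_norm_sq y).hasFDerivAt
    have h3 : fderiv ℝ (fun y : E3 => b (‖y‖ ^ 2)) y = _ := h2.fderiv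
    rw [h3]
    simp
    ring

end BMS

noncomputable section

/-! ### Pointwise bound on the sphere. -/

namespace BMS
open scoped Laplacian SchwartzMap ENNReal

theorem measurable_radialProj : Measurable radialProj := by
  have h : Measurable fun y : E3 =>
      if y = 0 then (EuclideanSpace.single 0 1 : E3) else ‖y‖⁻¹ • y := by
    refine Measurable.ite (measurableSet_singleton 0) measurable_const ?_
    fun_prop
  refine (MeasurableEmbedding.subtype_coe
    Metric.isClosed_sphere.measurableSet).measurable_comp_iff.1 ?_
  convert! h using 2 with y
  by_cases hy : y = 0 <;> simp [radialProj, hy]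

/-- Polar coordinates: `c` is the mass of `r² dr` on `(0, 2)`. The ball of radius `2` contains the
support of the cutoff. -/
theorem exists_map_radialProj_restrict_ball :
    ∃ c : ℝ≥0∞, c ≠ ⊤ ∧
      ((volume : Measure E3).restrict (Metric.ball 0 2)).map radialProj = c • sphereMeasure := by
  let I : Set (Set.Ioi (0 : ℝ)) := Set.Iio ⟨2, Set.mem_Ioi.2 two_pos⟩
  refine ⟨Measure.volumeIoiPow 2 I, ?_, ?_⟩
  · rw [Measure.volumeIoiPow_apply_Iio]
    exact ENNReal.ofReal_ne_top
  have hmp := (volume : Measure E3).measurePreserving_homeomorphUnitSphereProd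
  ext s hs
  have h2 : (homeomorphUnitSphereProd E3) ⁻¹' (s ×ˢ I) =
      (Subtype.val : ({0}ᶜ : Set E3) → E3) ⁻¹' (radialProj ⁻¹' s ∩ Metric.ball 0 2) := by
    ext z
    have hz : (z : E3) ≠ 0 := z.2
    have h3 : (homeomorphUnitSphereProd E3 z).1 = radialProj z := by
      apply Subtype.ext
      rw [radialProj_coe hz]
      exact homeomorphUnitSphereProd_apply_fst_coe E3 z
    have h4 : (homeomorphUnitSphereProd E3 z).2 ∈ I ↔ ‖(z : E3)‖ < 2 := by
      rw [← homeomorphUnitSphereProd_apply_snd_coe E3 z]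
      rfl
    simp [h3, h4]
  have hm := measurable_radialProj hs
  have h5 := hmp.measure_preimage (hs.prod measurableSet_Iio : MeasurableSet (s ×ˢ I)).nullMeasurableSet
  rw [h2, Measure.prod_prod, (MeasurableEmbedding.subtype_coe
    (measurableSet_singleton (0 : E3)).compl).comap_apply, Subtype.image_preimage_coe] at h5
  rw [Measure.map_apply measurable_radialProj hs, Measure.restrict_apply hm, Measure.smul_apply,
    smul_eq_mul, mul_comm]
  have h6 : Module.finrank ℝ E3 - 1 = 2 := by simp
  rw [h6] at h5
  refine Eq.trans ?_ h5
  -- Polar coordinates omit the origin, which is a null set.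
  refine measure_congr ?_
  have h7 : ({0}ᶜ : Set E3) =ᵐ[volume] Set.univ := by
    rw [MeasureTheory.ae_eq_univ]
    simp
  have h8 := ae_eq_set_inter h7 (Filter.EventuallyEq.refl (ae volume)
    (radialProj ⁻¹' s ∩ Metric.ball 0 2 : Set E3))
  rw [Set.univ_inter] at h8
  exact h8.symm

theorem norm_toL2 (α : SmoothFun) : ‖toL2 α‖ = (eLpNorm α 2 sphereMeasure).toReal := by
  rw [Lp.norm_def]
  congr 1
  exact eLpNorm_congr_ae (ContinuousMap.coeFn_toLp sphereMeasure (toContinuous α))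

theorem memLp_smoothFun (α : SmoothFun) : MemLp α 2 sphereMeasure :=
  (memLp_congr_ae (ContinuousMap.coeFn_toLp (p := 2) (𝕜 := ℝ) sphereMeasure (toContinuous α))).1
    (Lp.memLp (toL2 α))

/-- The Laplacian of the product of a radial function and a radially constant one has no
gradient term. -/
theorem laplacian_cutoff_mul_radialExt {φ : E3 → ℝ} (hφ : ContDiff ℝ ∞ φ)
    (hrad : ∀ y, ∃ c : ℝ, ∀ v, fderiv ℝ φ y v = c * inner ℝ y v) (α : SmoothFun) {y : E3}
    (hy : y ≠ 0) :
    Δ (fun z => φ z * radialExt α z) y =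
      φ y * ((‖y‖ ^ 2)⁻¹ * sphereLaplacian α (radialProj y)) + α (radialProj y) * Δ φ y := by
  rw [laplacian_mul (hφ.contDiffAt.of_le two_le_infty)
    ((contDiffAt_radialExt α hy).of_le two_le_infty), laplacian_radialExt α hy]
  -- The gradient term becomes `c` times the derivative of the extension along its own ray, which
  -- vanishes.
  obtain ⟨c, hc⟩ := hrad y
  simp only [hc, mul_assoc, ← Finset.mul_sum, sum_inner_mul_fderiv_apply,
    fderiv_radialExt_self α hy]
  simp [radialExt]

theorem toReal_eLpNorm_add_mul_abs_le {X : Type*} [MeasurableSpace X] {μ : Measure X}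
    {f g : X → ℝ} (hf : MemLp f 2 μ) (hg : MemLp g 2 μ) {a b : ℝ} (ha : 0 ≤ a) (hb : 0 ≤ b) :
    (eLpNorm (fun s => a * |f s| + b * |g s|) 2 μ).toReal ≤
      a * (eLpNorm f 2 μ).toReal + b * (eLpNorm g 2 μ).toReal := by
  have key : ∀ {f : X → ℝ} {a : ℝ}, 0 ≤ a →
      (eLpNorm (fun s => a * |f s|) 2 μ) = ENNReal.ofReal a * eLpNorm f 2 μ := by
    intro f a ha
    have h1 : (fun s => a * |f s|) = a • fun s => ‖f s‖ := rfl
    rw [h1, eLpNorm_const_smul, eLpNorm_norm, Real.enorm_eq_ofReal ha]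
  have h1 : eLpNorm (fun s => a * |f s| + b * |g s|) 2 μ ≤
      eLpNorm (fun s => a * |f s|) 2 μ + eLpNorm (fun s => b * |g s|) 2 μ :=
    eLpNorm_add_le (hf.norm.const_mul a).1 (hg.norm.const_mul b).1 one_le_two
  rw [key ha, key hb] at h1
  have hfa : ENNReal.ofReal a * eLpNorm f 2 μ ≠ ⊤ :=
    ENNReal.mul_ne_top ENNReal.ofReal_ne_top hf.2.ne
  have hgb : ENNReal.ofReal b * eLpNorm g 2 μ ≠ ⊤ :=
    ENNReal.mul_ne_top ENNReal.ofReal_ne_top hg.2.ne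
  have h2 := ENNReal.toReal_mono (ENNReal.add_ne_top.2 ⟨hfa, hgb⟩) h1
  rwa [ENNReal.toReal_add hfa hgb, ENNReal.toReal_mul, ENNReal.toReal_mul,
    ENNReal.toReal_ofReal ha, ENNReal.toReal_ofReal hb] at h2

/-- A smooth radial cutoff supported in a shell around the unit sphere. -/
structure RadialCutoff where
  toFun : E3 → ℝ
  contDiff : ContDiff ℝ ∞ toFun
  tsupport_subset : tsupport toFun ⊆ {y | 1 / 2 ≤ ‖y‖ ^ 2 ∧ ‖y‖ ^ 2 ≤ 3 / 2}
  nonneg : ∀ y, 0 ≤ toFun y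
  le_one : ∀ y, toFun y ≤ 1
  eq_one : ∀ x : S2, toFun x = 1
  radial : ∀ y, ∃ c : ℝ, ∀ v, fderiv ℝ toFun y v = c * inner ℝ y v

namespace RadialCutoff
variable (φ : RadialCutoff)

theorem tsupport_subset_ball {y : E3} (hy : y ∈ tsupport φ.toFun) : y ∈ Metric.ball (0 : E3) 2 := by
  have h := (φ.tsupport_subset hy).2
  rw [mem_ball_zero_iff]
  nlinarith [norm_nonneg y]

theorem ne_zero_of_mem_tsupport {y : E3} (hy : y ∈ tsupport φ.toFun) : y ≠ 0 := by
  rintro rfl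
  have := (φ.tsupport_subset hy).1
  norm_num at this

theorem hasCompactSupport : HasCompactSupport φ.toFun :=
  HasCompactSupport.of_support_subset_isCompact (isCompact_closedBall (0 : E3) 2)
    fun _ hy => Metric.ball_subset_closedBall (φ.tsupport_subset_ball (subset_tsupport _ hy))

theorem exists_abs_laplacian_le : ∃ M : ℝ, 0 ≤ M ∧ ∀ y, |Δ φ.toFun y| ≤ M := by
  have hcs : HasCompactSupport (Δ φ.toFun) := by
    refine φ.hasCompactSupport.mono' fun y hy => ?_
    by_contra hy'
    refine hy ?_
    have h0 : φ.toFun =ᶠ[nhds y] fun _ => 0 := notMem_tsupport_iff_eventuallyEq.1 hy'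
    rw [(InnerProductSpace.laplacian_congr_nhds h0).eq_of_nhds]
    simp
  have hcont : Continuous (Δ φ.toFun) := continuous_iff_continuousAt.2 fun y =>
    (contDiffAt_laplacian φ.contDiff.contDiffAt).continuousAt
  obtain ⟨M, hM⟩ := hcont.bounded_above_of_compact_support hcs
  exact ⟨M, (norm_nonneg _).trans (hM 0), hM⟩

/-- The cut off radially constant extension of a function on the sphere. -/
def ext (α : S2 → ℝ) : E3 → ℝ := fun y => φ.toFun y * radialExt α y

theorem ext_eventuallyEq (α : S2 → ℝ) {y : E3} (hy : y ∉ tsupport φ.toFun) :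
    φ.ext α =ᶠ[nhds y] fun _ => 0 := by
  filter_upwards [notMem_tsupport_iff_eventuallyEq.1 hy] with z hz
  simp [ext, hz]

theorem ext_coe (α : S2 → ℝ) (x : S2) : φ.ext α x = α x := by
  simp [ext, φ.eq_one, radialExt, radialProj_coe_sphere]

theorem contDiff_ext (α : SmoothFun) : ContDiff ℝ ∞ (φ.ext α) :=
  contDiff_iff_contDiffAt.2 fun y => by
    by_cases hy : y ∈ tsupport φ.toFun
    · exact φ.contDiff.contDiffAt.mul (contDiffAt_radialExt α (φ.ne_zero_of_mem_tsupport hy))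
    · exact contDiffAt_const.congr_of_eventuallyEq (φ.ext_eventuallyEq α hy)

theorem hasCompactSupport_ext (α : S2 → ℝ) : HasCompactSupport (fun y => (φ.ext α y : ℂ)) :=
  φ.hasCompactSupport.mono fun y hy hy' => hy (by simp [ext, hy'])

/-- The cut off extension as a Schwartz function. -/
def schwartzExt (α : SmoothFun) : 𝓢(E3, ℂ) :=
  (φ.hasCompactSupport_ext α).toSchwartzMap (Complex.ofRealCLM.contDiff.comp (φ.contDiff_ext α))

theorem schwartzExt_apply (α : SmoothFun) (y : E3) : φ.schwartzExt α y = (φ.ext α y : ℂ) := rfl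

theorem laplacian_schwartzExt (α : SmoothFun) (y : E3) :
    Δ (φ.schwartzExt α) y = ((Δ (φ.ext α) y : ℝ) : ℂ) := by
  rw [SchwartzMap.laplacian_apply]
  exact ((φ.contDiff_ext α).contDiffAt.of_le two_le_infty).laplacian_CLM_comp_left
    (l := Complex.ofRealCLM)

/-- On the shell `‖y‖⁻² ≤ 2` and `0 ≤ φ ≤ 1`. The coefficient `M + 1` collects the zeroth-order term
and the one carrying `Δ φ`. -/
theorem abs_ext_sub_laplacian_le (α : SmoothFun) {M : ℝ} (hM : ∀ y, |Δ φ.toFun y| ≤ M) {y : E3}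
    (hy : y ∈ tsupport φ.toFun) :
    |φ.ext α y - Δ (φ.ext α) y| ≤
      (M + 1) * |α (radialProj y)| + 2 * |sphereLaplacian α (radialProj y)| := by
  have hs := φ.tsupport_subset hy
  have h2 : |φ.toFun y| ≤ 1 := by rw [abs_of_nonneg (φ.nonneg y)]; exact φ.le_one y
  have hΔ : Δ (φ.ext α) y = _ :=
    laplacian_cutoff_mul_radialExt φ.contDiff φ.radial α (φ.ne_zero_of_mem_tsupport hy)
  have h3 : |φ.toFun y * ((‖y‖ ^ 2)⁻¹ * sphereLaplacian α (radialProj y))|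
      ≤ 2 * |sphereLaplacian α (radialProj y)| := by
    rw [abs_mul, abs_mul, abs_of_nonneg (a := (‖y‖ ^ 2)⁻¹) (by positivity)]
    have h4 : (‖y‖ ^ 2)⁻¹ ≤ 2 := by
      rw [inv_le_comm₀ (by linarith [hs.1]) two_pos]
      linarith [hs.1]
    calc _ ≤ 1 * (2 * |sphereLaplacian α (radialProj y)|) := by gcongr
      _ = _ := one_mul _
  have h5 : |α (radialProj y) * Δ φ.toFun y| ≤ M * |α (radialProj y)| := by
    rw [abs_mul, mul_comm]
    exact mul_le_mul_of_nonneg_right (hM y) (abs_nonneg _)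
  have h6 : |φ.ext α y| ≤ |α (radialProj y)| := by
    rw [ext, abs_mul]
    exact mul_le_of_le_one_left (abs_nonneg _) h2
  rw [hΔ]
  refine (abs_sub _ _).trans ?_
  refine (add_le_add h6 ((abs_add_le _ _).trans (add_le_add h3 h5))).trans (le_of_eq ?_)
  ring

theorem norm_schwartzExt_sub_laplacian_le (α : SmoothFun) {M : ℝ} (hM : ∀ y, |Δ φ.toFun y| ≤ M)
    (y : E3) :
    ‖(φ.schwartzExt α - Δ (φ.schwartzExt α)) y‖ ≤ ‖(Metric.ball 0 2).indicator
      ((fun s => (M + 1) * |α s| + 2 * |sphereLaplacian α s|) ∘ radialProj) y‖ := by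
  have h1 : (φ.schwartzExt α - Δ (φ.schwartzExt α)) y =
      ((φ.ext α y - Δ (φ.ext α) y : ℝ) : ℂ) := by
    rw [sub_apply, schwartzExt_apply, laplacian_schwartzExt, Complex.ofReal_sub]
  rw [h1, Complex.norm_real]
  by_cases hy : y ∈ tsupport φ.toFun
  · rw [Set.indicator_of_mem (φ.tsupport_subset_ball hy)]
    exact (φ.abs_ext_sub_laplacian_le α hM hy).trans (le_abs_self _)
  · rw [(InnerProductSpace.laplacian_congr_nhds (φ.ext_eventuallyEq α hy)).eq_of_nhds,
      (φ.ext_eventuallyEq α hy).eq_of_nhds]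
    simp

end RadialCutoff

theorem exists_toReal_eLpNorm_le_of_radialProj : ∃ c : ℝ, 0 ≤ c ∧
    ∀ (F : E3 → ℂ) (h : S2 → ℝ), MemLp h 2 sphereMeasure →
      (∀ y, ‖F y‖ ≤ ‖(Metric.ball 0 2).indicator (h ∘ radialProj) y‖) →
      (eLpNorm F 2 volume).toReal ≤ c * (eLpNorm h 2 sphereMeasure).toReal := by
  obtain ⟨c, hc, hmap⟩ := exists_map_radialProj_restrict_ball
  refine ⟨(c ^ (1 / (2 : ℝ≥0∞)).toReal).toReal, ENNReal.toReal_nonneg, fun F h hh hF => ?_⟩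
  have h1 : eLpNorm F 2 volume ≤ _ := eLpNorm_mono hF
  rw [eLpNorm_indicator_eq_eLpNorm_restrict measurableSet_ball,
    ← eLpNorm_map_measure (by rw [hmap]; exact hh.1.smul_measure c)
      measurable_radialProj.aemeasurable, hmap,
    eLpNorm_smul_measure_of_ne_top (by simp), smul_eq_mul] at h1
  rw [← ENNReal.toReal_mul]
  refine ENNReal.toReal_mono (ENNReal.mul_ne_top ?_ hh.2.ne) h1
  exact ENNReal.rpow_ne_top_of_nonneg (by positivity) hc

/-- Pointwise bound of a smooth function on the sphere by its `L²` norm and that of its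
Laplacian. -/
theorem exists_abs_le_norm_toL2 : ∃ C : ℝ, 0 ≤ C ∧ ∀ (α : SmoothFun) (x : S2),
    |α x| ≤ C * (‖toL2 α‖ + ‖toL2 (sphereLaplacian α)‖) := by
  obtain ⟨C, hC, hsob⟩ := exists_norm_le_eLpNorm_sub_laplacian (E := E3) (by simp)
  obtain ⟨c, hc, hmap⟩ := exists_toReal_eLpNorm_le_of_radialProj
  obtain ⟨φ, h1, h2, h3, h4, h5, h6⟩ := exists_radial_cutoff
  let φ : RadialCutoff := ⟨φ, h1, h2, h3, h4, h5, h6⟩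
  obtain ⟨M, hM0, hM⟩ := φ.exists_abs_laplacian_le
  -- `C` is the Sobolev constant, `c` comes from polar coordinates, and `M + 3` dominates both `M +
  -- 1` and `2`.
  refine ⟨C * c * (M + 3), by positivity, fun α x => ?_⟩
  have hαm := memLp_smoothFun α
  have hΔm := memLp_smoothFun (sphereLaplacian α)
  have hL2 := hmap _ _ ((hαm.norm.const_mul (M + 1)).add (hΔm.norm.const_mul 2))
    (φ.norm_schwartzExt_sub_laplacian_le α hM)
  have hnorm := toReal_eLpNorm_add_mul_abs_le hαm hΔm (by positivity : 0 ≤ M + 1) zero_le_two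
  rw [← norm_toL2, ← norm_toL2] at hnorm
  have hfx : ‖φ.schwartzExt α x‖ = |α x| := by
    rw [φ.schwartzExt_apply, φ.ext_coe, Complex.norm_real, Real.norm_eq_abs]
  have h0 := norm_nonneg (toL2 α)
  have h0' := norm_nonneg (toL2 (sphereLaplacian α))
  rw [← hfx, mul_assoc, mul_assoc]
  refine (hsob _ x).trans (mul_le_mul_of_nonneg_left ?_ hC)
  refine hL2.trans (mul_le_mul_of_nonneg_left ?_ hc)
  refine hnorm.trans ?_
  nlinarith

end BMS

end

noncomputable section

/-! ### Orthonormal-or-zero sequences and Gaussian sequences. -/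

namespace BMS

/-- A sequence of pairwise orthogonal vectors each of which is a unit vector or zero. -/
structure IsOrthoSeq {H : Type*} [NormedAddCommGroup H] [InnerProductSpace ℝ H] (g : ℕ → H) :
    Prop where
  inner_eq_zero : ∀ i j, i ≠ j → inner ℝ (g i) (g j) = 0
  norm_eq_one_or : ∀ i, ‖g i‖ = 1 ∨ g i = 0

namespace IsOrthoSeq
variable {H : Type*} [NormedAddCommGroup H] [InnerProductSpace ℝ H] {g : ℕ → H}

theorem norm_sq_le_one (hg : IsOrthoSeq g) (n : ℕ) : ‖g n‖ ^ 2 ≤ 1 := by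
  rcases hg.norm_eq_one_or n with h | h <;> simp [h]

theorem norm_sq_smul (hg : IsOrthoSeq g) (n : ℕ) : ‖g n‖ ^ 2 • g n = g n := by
  rcases hg.norm_eq_one_or n with h | h <;> simp [h]

theorem norm_sq_sum (hg : IsOrthoSeq g) (F : Finset ℕ) (c : ℕ → ℝ) :
    ‖∑ n ∈ F, c n • g n‖ ^ 2 = ∑ n ∈ F, c n ^ 2 * ‖g n‖ ^ 2 := by
  rw [← real_inner_self_eq_norm_sq, sum_inner]
  refine Finset.sum_congr rfl fun n hn => ?_
  rw [inner_sum, Finset.sum_eq_single n]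
  · rw [real_inner_smul_left, real_inner_smul_right, real_inner_self_eq_norm_sq]
    ring
  · intro m _ hm
    rw [real_inner_smul_left, real_inner_smul_right, hg.inner_eq_zero n m hm.symm]
    simp
  · exact fun h => absurd hn h

theorem norm_sq_sum_le (hg : IsOrthoSeq g) (F : Finset ℕ) (c : ℕ → ℝ) :
    ‖∑ n ∈ F, c n • g n‖ ^ 2 ≤ ∑ n ∈ F, c n ^ 2 := by
  rw [hg.norm_sq_sum]
  exact Finset.sum_le_sum fun n _ => mul_le_of_le_one_right (sq_nonneg _) (hg.norm_sq_le_one n)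

theorem norm_sq_sub_sum_inner (hg : IsOrthoSeq g) (F : Finset ℕ) (w : H) :
    ‖w - ∑ n ∈ F, inner ℝ (g n) w • g n‖ ^ 2 = ‖w‖ ^ 2 - ∑ n ∈ F, inner ℝ (g n) w ^ 2 := by
  rw [norm_sub_sq_real, hg.norm_sq_sum, inner_sum]
  have h1 : ∑ n ∈ F, inner ℝ w (inner ℝ (g n) w • g n) = ∑ n ∈ F, inner ℝ (g n) w ^ 2 :=
    Finset.sum_congr rfl fun n _ => by rw [real_inner_smul_right, real_inner_comm, sq]
  have h2 : ∑ n ∈ F, inner ℝ (g n) w ^ 2 * ‖g n‖ ^ 2 = ∑ n ∈ F, inner ℝ (g n) w ^ 2 :=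
    Finset.sum_congr rfl fun n _ => by
      rcases hg.norm_eq_one_or n with h | h <;> simp [h]
  rw [h1, h2]
  ring

theorem norm_sub_sum_inner_le (hg : IsOrthoSeq g) (F : Finset ℕ) (w : H) :
    ‖w - ∑ n ∈ F, inner ℝ (g n) w • g n‖ ≤ ‖w‖ := by
  refine le_of_sq_le_sq ?_ (norm_nonneg _)
  rw [hg.norm_sq_sub_sum_inner]
  exact sub_le_self _ (Finset.sum_nonneg fun n _ => sq_nonneg _)

theorem sum_inner_smul_eq (hg : IsOrthoSeq g) {N : ℕ} {y : H}
    (hy : y ∈ Submodule.span ℝ (g '' Set.Iio N)) :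
    ∑ n ∈ Finset.range N, inner ℝ (g n) y • g n = y := by
  induction hy using Submodule.span_induction with
  | mem x hx =>
    obtain ⟨m, hm, rfl⟩ := hx
    rw [Finset.sum_eq_single m]
    · rw [real_inner_self_eq_norm_sq, hg.norm_sq_smul]
    · intro n _ hn
      rw [hg.inner_eq_zero n m hn, zero_smul]
    · exact fun h => absurd (Finset.mem_range.2 hm) h
  | zero => simp
  | add x y _ _ hx hy =>
    simp only [inner_add_right, add_smul, Finset.sum_add_distrib, hx, hy]
  | smul a x _ hx =>
    simp only [real_inner_smul_right, mul_smul, ← Finset.smul_sum, hx]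

theorem sum_inner_sq_eq (hg : IsOrthoSeq g) {N : ℕ} {y : H}
    (hy : y ∈ Submodule.span ℝ (g '' Set.Iio N)) :
    ∑ n ∈ Finset.range N, inner ℝ (g n) y ^ 2 = ‖y‖ ^ 2 := by
  have h := hg.norm_sq_sub_sum_inner (Finset.range N) y
  rw [hg.sum_inner_smul_eq hy, sub_self, norm_zero] at h
  linarith

theorem summable_smul [CompleteSpace H] (hg : IsOrthoSeq g) {c : ℕ → ℝ}
    (hc : Summable fun n => c n ^ 2) : Summable fun n => c n • g n := by
  rw [summable_iff_vanishing_norm] at hc ⊢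
  intro ε hε
  obtain ⟨s, hs⟩ := hc (ε ^ 2) (by positivity)
  refine ⟨s, fun t ht => lt_of_pow_lt_pow_left₀ 2 hε.le ?_⟩
  exact ((hg.norm_sq_sum_le t c).trans (le_abs_self _)).trans_lt (hs t ht)

end IsOrthoSeq

/-- Gram–Schmidt returns zero on a vector dependent on its predecessors, which is why `IsOrthoSeq`
admits zeros. -/
theorem isOrthoSeq_gramSchmidtNormed {H : Type*} [NormedAddCommGroup H] [InnerProductSpace ℝ H]
    (f : ℕ → H) : IsOrthoSeq (InnerProductSpace.gramSchmidtNormed ℝ f) where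
  inner_eq_zero i j hij := by
    simp only [InnerProductSpace.gramSchmidtNormed, real_inner_smul_left, real_inner_smul_right,
      InnerProductSpace.gramSchmidt_orthogonal ℝ f hij, mul_zero]
  norm_eq_one_or i := by
    by_cases h : InnerProductSpace.gramSchmidtNormed ℝ f i = 0
    · exact Or.inr h
    · exact Or.inl (InnerProductSpace.gramSchmidtNormed_unit_length' h)

theorem span_gramSchmidtNormed_Iio {H : Type*} [NormedAddCommGroup H] [InnerProductSpace ℝ H]
    (f : ℕ → H) (N : ℕ) :
    Submodule.span ℝ (InnerProductSpace.gramSchmidtNormed ℝ f '' Set.Iio N) =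
      Submodule.span ℝ (f '' Set.Iio N) := by
  rw [InnerProductSpace.span_gramSchmidtNormed, InnerProductSpace.span_gramSchmidt_Iio]

/-- The law of a sequence of independent standard Gaussian variables. -/
def stdGaussianSeq : Measure (ℕ → ℝ) :=
  Measure.infinitePi fun _ => ProbabilityTheory.gaussianReal 0 1

instance : IsProbabilityMeasure stdGaussianSeq := by
  unfold stdGaussianSeq; infer_instance

theorem integral_cexp_sum_stdGaussianSeq (F : Finset ℕ) (a : ℕ → ℝ) :
    ∫ z, Complex.exp (Complex.I * ((∑ n ∈ F, a n * z n : ℝ) : ℂ)) ∂stdGaussianSeq =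
      Complex.exp (-(1 / 2 : ℂ) * ((∑ n ∈ F, a n ^ 2 : ℝ) : ℂ)) := by
  have hind := ProbabilityTheory.iIndepFun_infinitePi
    (P := fun _ : ℕ => ProbabilityTheory.gaussianReal 0 1) (X := fun _ x => x)
    fun _ => measurable_id
  have hind' := hind.precomp (g := fun n : F => (n : ℕ)) Subtype.val_injective
  have h := hind'.integral_fun_prod_comp
    (f := fun (n : F) (x : ℝ) => Complex.exp (Complex.I * ((a n * x : ℝ) : ℂ)))
    (fun n => (measurable_pi_apply _).aemeasurable)
    (fun n => Continuous.aestronglyMeasurable (by fun_prop))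
  have h1 : ∀ z : ℕ → ℝ, Complex.exp (Complex.I * ((∑ n ∈ F, a n * z n : ℝ) : ℂ)) =
      ∏ n : F, Complex.exp (Complex.I * ((a n * z n : ℝ) : ℂ)) := fun z => by
    rw [← Complex.exp_sum, ← Finset.mul_sum, ← Complex.ofReal_sum,
      Finset.sum_coe_sort F fun n => a n * z n]
  have h2 : ∀ n : ℕ, ∫ z, Complex.exp (Complex.I * ((a n * z n : ℝ) : ℂ)) ∂stdGaussianSeq =
      Complex.exp (-(1 / 2 : ℂ) * ((a n ^ 2 : ℝ) : ℂ)) := fun n => by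
    have hm : Measure.map (fun z : ℕ → ℝ => z n) stdGaussianSeq =
      ProbabilityTheory.gaussianReal 0 1 := Measure.infinitePi_map_eval _ n
    have h3 := ProbabilityTheory.charFun_gaussianReal (μ := 0) (v := 1) (a n)
    rw [charFun_apply_real, ← hm, integral_map (measurable_pi_apply n).aemeasurable
      (Continuous.aestronglyMeasurable (by fun_prop))] at h3
    convert! h3 using 1
    · refine integral_congr_ae (Filter.Eventually.of_forall fun z => ?_)
      simp only
      congr 1
      push_cast
      ring
    · congr 1
      push_cast
      simp
      ring
  simp_rw [h1]
  refine (h.trans (Finset.prod_congr rfl fun (n : F) _ => h2 n)).trans ?_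
  rw [← Complex.exp_sum, ← Finset.mul_sum,
    ← Complex.ofReal_sum, Finset.sum_coe_sort F fun n => a n ^ 2]

/-- The hypothesis is the characteristic function of the centred normal law of variance `r`, so `η`
has that law. -/
theorem lintegral_sq_of_integral_cexp {Ω : Type*} [MeasurableSpace Ω] {P : Measure Ω}
    [IsProbabilityMeasure P] {η : Ω → ℝ} (hη : Measurable η) {r : ℝ} (hr : 0 ≤ r)
    (h : ∀ t : ℝ, ∫ z, Complex.exp (Complex.I * ((t * η z : ℝ) : ℂ)) ∂P =
      Complex.exp (-(1 / 2 : ℂ) * ((t ^ 2 * r : ℝ) : ℂ))) :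
    ∫⁻ z, ENNReal.ofReal (η z ^ 2) ∂P = ENNReal.ofReal r := by
  lift r to NNReal using hr
  have hmap : P.map η = ProbabilityTheory.gaussianReal 0 r := by
    have := Measure.isProbabilityMeasure_map (μ := P) hη.aemeasurable
    refine Measure.ext_of_charFun (funext fun t => ?_)
    rw [ProbabilityTheory.charFun_gaussianReal, charFun_apply_real, integral_map hη.aemeasurable
      (Continuous.aestronglyMeasurable (by fun_prop))]
    convert! h t using 1
    · refine integral_congr_ae (Filter.Eventually.of_forall fun z => ?_)
      simp only
      congr 1
      push_cast
      ring
    · congr 1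
      push_cast
      simp
      ring
  have h1 : ∫⁻ x : ℝ, ENNReal.ofReal (x ^ 2) ∂(P.map η) = ENNReal.ofReal r := by
    rw [hmap, ← ofReal_integral_eq_lintegral_ofReal]
    · have h2 := ProbabilityTheory.variance_id_gaussianReal (μ := 0) (v := r)
      rw [ProbabilityTheory.variance_of_integral_eq_zero aemeasurable_id
        ProbabilityTheory.integral_id_gaussianReal] at h2
      rw [← h2]
      rfl
    · exact (ProbabilityTheory.memLp_id_gaussianReal (μ := 0) (v := r) 2).integrable_sq
    · exact Filter.Eventually.of_forall fun x => sq_nonneg x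
  rw [lintegral_map (by fun_prop) hη] at h1
  exact h1

/-- A centred Gaussian sequence with prescribed covariance. -/
theorem exists_gaussian_seq {G : Type*} [NormedAddCommGroup G] [InnerProductSpace ℝ G]
    (x : ℕ → G) : ∃ η : ℕ → (ℕ → ℝ) → ℝ, (∀ n, Measurable (η n)) ∧
      ∀ (N : ℕ) (c : ℕ → ℝ),
        ∫ z, Complex.exp (Complex.I * ((∑ m ∈ Finset.range N, c m * η m z : ℝ) : ℂ))
          ∂stdGaussianSeq =
        Complex.exp (-(1 / 2 : ℂ) * ((‖∑ m ∈ Finset.range N, c m • x m‖ ^ 2 : ℝ) : ℂ)) := by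
  let g := InnerProductSpace.gramSchmidtNormed ℝ x
  have hg : IsOrthoSeq g := isOrthoSeq_gramSchmidtNormed x
  have htri : ∀ {m n : ℕ}, m < n → inner ℝ (g n) (x m) = 0 := fun {m n} h => by
    simp only [g, InnerProductSpace.gramSchmidtNormed, real_inner_smul_left,
      InnerProductSpace.gramSchmidt_inv_triangular ℝ x h, mul_zero]
  -- Each `x m` is replaced by its Gram–Schmidt coordinates paired with independent standard
  -- Gaussians. By triangularity only `n ≤ m` contributes, so every sum is finite.
  refine ⟨fun m z => ∑ n ∈ Finset.range (m + 1), inner ℝ (g n) (x m) * z n,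
    fun m => by fun_prop, fun N c => ?_⟩
  set y := ∑ m ∈ Finset.range N, c m • x m with hy
  have hyspan : y ∈ Submodule.span ℝ (g '' Set.Iio N) := by
    rw [span_gramSchmidtNormed_Iio]
    exact Submodule.sum_mem _ fun m hm => Submodule.smul_mem _ _
      (Submodule.subset_span ⟨m, Finset.mem_range.1 hm, rfl⟩)
  rw [← hg.sum_inner_sq_eq hyspan, ← integral_cexp_sum_stdGaussianSeq]
  refine integral_congr_ae (Filter.Eventually.of_forall fun z => ?_)
  simp only
  congr 3
  have h1 : ∀ m ∈ Finset.range N, c m * ∑ n ∈ Finset.range (m + 1), inner ℝ (g n) (x m) * z n =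
      ∑ n ∈ Finset.range N, c m * (inner ℝ (g n) (x m) * z n) := fun m hm => by
    rw [Finset.mul_sum]
    refine Finset.sum_subset (Finset.range_subset_range.2 (Finset.mem_range.1 hm))
      fun n _ hn => ?_
    rw [htri (by simpa using hn)]
    simp
  rw [Finset.sum_congr rfl h1, Finset.sum_comm]
  refine Finset.sum_congr rfl fun n _ => ?_
  rw [hy, inner_sum, Finset.sum_mul]
  refine Finset.sum_congr rfl fun m _ => ?_
  rw [real_inner_smul_right, mul_assoc]

end BMS

end

noncomputable section

/-! ### Gaussian vectors from a Hilbert–Schmidt condition. -/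

namespace BMS
open Filter Topology

variable {V H G : Type*} [AddCommGroup V] [Module ℝ V] [NormedAddCommGroup H]
  [InnerProductSpace ℝ H] [NormedAddCommGroup G] [InnerProductSpace ℝ G]

/-- A linear map into a separable pre-Hilbert space has an orthonormal-or-zero sequence in its
range, whose partial Fourier sums recover every vector of the range. -/
theorem exists_isOrthoSeq_tendsto [SecondCountableTopology H] (L : V →ₗ[ℝ] H) :
    ∃ α : ℕ → V, IsOrthoSeq (fun n => L (α n)) ∧ ∀ β,
      Tendsto (fun N => L (∑ n ∈ Finset.range N, inner ℝ (L (α n)) (L β) • α n)) atTop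
        (𝓝 (L β)) := by
  let v : ℕ → LinearMap.range L := TopologicalSpace.denseSeq (LinearMap.range L)
  let f : ℕ → H := fun n => v n
  let g := InnerProductSpace.gramSchmidtNormed ℝ f
  have hg : IsOrthoSeq g := isOrthoSeq_gramSchmidtNormed f
  have hspan : ∀ N, Submodule.span ℝ (g '' Set.Iio N) = Submodule.span ℝ (f '' Set.Iio N) :=
    span_gramSchmidtNormed_Iio f
  have hrange : ∀ n, g n ∈ LinearMap.range L := fun n => by
    have h1 : g n ∈ Submodule.span ℝ (g '' Set.Iio (n + 1)) :=
      Submodule.subset_span ⟨n, Nat.lt_succ_self n, rfl⟩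
    rw [hspan] at h1
    refine Submodule.span_le.2 ?_ h1
    rintro _ ⟨m, _, rfl⟩
    exact (v m).2
  choose α hα using hrange
  have hα' : (fun n => L (α n)) = g := funext hα
  refine ⟨α, by rwa [hα'], fun β => ?_⟩
  simp only [map_sum, map_smul, hα]
  rw [Metric.tendsto_atTop]
  intro ε hε
  obtain ⟨m, hm⟩ := (TopologicalSpace.denseRange_denseSeq (LinearMap.range L)).exists_dist_lt
    ⟨L β, LinearMap.mem_range_self L β⟩ hε
  refine ⟨m + 1, fun N hN => ?_⟩
  have hfm : f m ∈ Submodule.span ℝ (g '' Set.Iio N) := by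
    rw [hspan]
    exact Submodule.subset_span ⟨m, hN, rfl⟩
  have h1 := hg.norm_sub_sum_inner_le (Finset.range N) (L β - f m)
  -- The partial sum fixes `f m`, so subtracting `f m` does not change the remainder, whose norm is
  -- then at most the distance from `L β` to `f m`.
  have h2 : L β - f m - ∑ n ∈ Finset.range N, inner ℝ (g n) (L β - f m) • g n =
      L β - ∑ n ∈ Finset.range N, inner ℝ (g n) (L β) • g n := by
    simp only [inner_sub_right, sub_smul, Finset.sum_sub_distrib, hg.sum_inner_smul_eq hfm]
    abel
  rw [h2] at h1
  rw [dist_comm, dist_eq_norm]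
  refine h1.trans_lt ?_
  rw [← dist_eq_norm]
  exact hm

theorem ae_summable_sq_of_tsum_lintegral {Ω : Type*} [MeasurableSpace Ω] {P : Measure Ω}
    {η : ℕ → Ω → ℝ} (hη : ∀ n, Measurable (η n))
    (h : ∑' n, ∫⁻ z, ENNReal.ofReal (η n z ^ 2) ∂P ≠ ⊤) :
    ∀ᵐ z ∂P, ∑' n, ENNReal.ofReal (η n z ^ 2) ≠ ⊤ := by
  have hm : ∀ n, Measurable fun z => ENNReal.ofReal (η n z ^ 2) := fun n => by fun_prop
  rw [← lintegral_tsum fun n => (hm n).aemeasurable] at h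
  filter_upwards [ae_lt_top (Measurable.tsum hm) h] with z hz using hz.ne

theorem tendsto_integral_cexp {Ω : Type*} [MeasurableSpace Ω] {P : Measure Ω}
    [IsProbabilityMeasure P] {Y : ℕ → Ω → ℝ} {Z : Ω → ℝ} (hY : ∀ n, Measurable (Y n))
    (h : ∀ᵐ z ∂P, Tendsto (fun n => Y n z) atTop (𝓝 (Z z))) :
    Tendsto (fun n => ∫ z, Complex.exp (Complex.I * (Y n z : ℂ)) ∂P) atTop
      (𝓝 (∫ z, Complex.exp (Complex.I * (Z z : ℂ)) ∂P)) := by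
  refine tendsto_integral_of_dominated_convergence (fun _ => 1) (fun n => ?_)
    (integrable_const _) (fun n => ?_) ?_
  · exact (Measurable.aestronglyMeasurable (by fun_prop))
  · refine Eventually.of_forall fun z => ?_
    rw [mul_comm, Complex.norm_exp_ofReal_mul_I]
  · filter_upwards [h] with z hz
    have hc : Continuous fun t : ℝ => Complex.exp (Complex.I * (t : ℂ)) := by fun_prop
    exact (hc.tendsto _).comp hz

/-- If `J` factors through `L` by a Hilbert–Schmidt map, then the cylindrical Gaussian law with
covariance `‖J β‖²` is carried by random vectors in the Hilbert space of `L`. -/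
theorem exists_gaussian_vector [CompleteSpace H] [SecondCountableTopology H]
    (L : V →ₗ[ℝ] H) (J : V →ₗ[ℝ] G) {C D : ℝ} (hJ : ∀ β, ‖J β‖ ≤ C * ‖L β‖)
    (hHS : ∀ α : ℕ → V, IsOrthoSeq (fun n => L (α n)) →
      ∀ N, ∑ n ∈ Finset.range N, ‖J (α n)‖ ^ 2 ≤ D) :
    ∃ X : (ℕ → ℝ) → H, (∀ β, Measurable fun z => inner ℝ (X z) (L β)) ∧
      ∀ β, ∫ z, Complex.exp (Complex.I * (inner ℝ (X z) (L β) : ℝ)) ∂stdGaussianSeq =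
        Complex.exp (-(1 / 2 : ℂ) * ((‖J β‖ ^ 2 : ℝ) : ℂ)) := by
  obtain ⟨α, hα, hlim⟩ := exists_isOrthoSeq_tendsto L
  obtain ⟨η, hη, hchar⟩ := exists_gaussian_seq fun n => J (α n)
  have hvar : ∀ n, ∫⁻ z, ENNReal.ofReal (η n z ^ 2) ∂stdGaussianSeq =
      ENNReal.ofReal (‖J (α n)‖ ^ 2) := fun n => by
    refine lintegral_sq_of_integral_cexp (hη n) (sq_nonneg _) fun t => ?_
    -- Coefficients `t` at `n` and zero elsewhere isolate the law of `η n`.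
    have h := hchar (n + 1) fun m => if m = n then t else 0
    simpa [norm_smul, mul_pow] using h
  have hfin : ∑' n, ∫⁻ z, ENNReal.ofReal (η n z ^ 2) ∂stdGaussianSeq ≠ ⊤ := by
    simp only [hvar]
    refine ne_top_of_le_ne_top (ENNReal.ofReal_ne_top (r := D)) ?_
    refine ENNReal.tsum_le_of_sum_range_le fun N => ?_
    rw [← ENNReal.ofReal_sum_of_nonneg fun n _ => sq_nonneg _]
    exact ENNReal.ofReal_le_ofReal (hHS α hα N)
  let S : Set (ℕ → ℝ) := {z | ∑' n, ENNReal.ofReal (η n z ^ 2) ≠ ⊤}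
  have hSae : ∀ᵐ z ∂stdGaussianSeq, z ∈ S := ae_summable_sq_of_tsum_lintegral hη hfin
  have hSm : MeasurableSet S := by
    have h1 : Measurable fun z => ∑' n, ENNReal.ofReal (η n z ^ 2) :=
      Measurable.tsum fun n => by fun_prop
    exact (h1 (measurableSet_singleton ⊤)).compl
  have hsum : ∀ z ∈ S, Summable fun n => η n z • L (α n) := fun z hz => by
    refine hα.summable_smul ((summable_congr fun n => ?_).1 (ENNReal.summable_toReal hz))
    exact ENNReal.toReal_ofReal (sq_nonneg _)
  -- Setting `X = 0` off the measurable full-measure set `S` makes its pairings everywhere limits of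
  -- measurable functions.
  let X : (ℕ → ℝ) → H := S.indicator fun z => ∑' n, η n z • L (α n)
  let Y : V → ℕ → (ℕ → ℝ) → ℝ := fun β N z =>
    ∑ n ∈ Finset.range N, inner ℝ (L (α n)) (L β) * η n z
  have hY : ∀ β N, Measurable (Y β N) := fun β N => by fun_prop
  have hYX : ∀ β, ∀ z ∈ S, Tendsto (fun N => Y β N z) atTop (𝓝 (inner ℝ (X z) (L β))) := by
    intro β z hz
    have h1 := ((hsum z hz).hasSum.mapL (innerSL ℝ (L β))).tendsto_sum_nat
    simp only [X, Set.indicator_of_mem hz]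
    rw [real_inner_comm]
    refine h1.congr fun N => Finset.sum_congr rfl fun n _ => ?_
    rw [innerSL_apply_apply, real_inner_smul_right, real_inner_comm, mul_comm]
  refine ⟨X, fun β => ?_, fun β => ?_⟩
  · refine measurable_of_tendsto_metrizable (f := fun N => S.indicator (Y β N))
      (fun N => (hY β N).indicator hSm) (tendsto_pi_nhds.2 fun z => ?_)
    by_cases hz : z ∈ S
    · simpa only [Set.indicator_of_mem hz] using hYX β z hz
    · simp [X, Set.indicator_of_notMem hz]
  · have h1 := tendsto_integral_cexp (hY β) (hSae.mono (hYX β))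
    refine tendsto_nhds_unique h1 ?_
    simp only [Y, hchar]
    -- `J` is bounded by `L`, so convergence of the Fourier sums in the norm of `L` passes to `J`;
    -- hence the variances converge.
    have h2 : Tendsto (fun N => J (∑ n ∈ Finset.range N, inner ℝ (L (α n)) (L β) • α n)) atTop
        (𝓝 (J β)) := by
      rw [tendsto_iff_norm_sub_tendsto_zero]
      have h3 := (tendsto_iff_norm_sub_tendsto_zero.1 (hlim β)).const_mul C
      rw [mul_zero] at h3
      refine squeeze_zero (fun _ => norm_nonneg _) (fun N => ?_) h3
      rw [← map_sub, ← map_sub]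
      exact hJ _
    simp only [map_sum, map_smul] at h2
    have hc : Continuous fun w : G =>
      Complex.exp (-(1 / 2 : ℂ) * ((‖w‖ ^ 2 : ℝ) : ℂ)) := by fun_prop
    exact (hc.tendsto _).comp h2

end BMS

end

noncomputable section

namespace BMS

/-! ### Cylinder σ-algebra and uniqueness. -/

section Cylinder
variable {k : ℝ}

/-- The embedding of distributions into all real functions on the test space. -/
def evalAll (β : Distributions k) : TestSpace k → ℝ := fun α => pairing β α

theorem measurableSpace_distributions_eq_comap :
    (inferInstance : MeasurableSpace (Distributions k)) =
      MeasurableSpace.comap evalAll MeasurableSpace.pi := by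
  simp only [MeasurableSpace.pi, MeasurableSpace.comap_iSup, MeasurableSpace.comap_comp]
  rfl

theorem measurable_evalAll : Measurable (evalAll (k := k)) := by
  rw [measurable_iff_comap_le, ← measurableSpace_distributions_eq_comap]

theorem measurable_pairing (α : TestSpace k) : Measurable fun β : Distributions k => pairing β α :=
  (measurable_pi_apply α).comp measurable_evalAll

theorem measurable_distributions {Ω : Type*} [MeasurableSpace Ω] {T : Ω → Distributions k}
    (hT : ∀ α, Measurable fun z => pairing (T z) α) : Measurable T := by
  have h : Measurable (evalAll ∘ T) := measurable_pi_iff.2 hT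
  rw [measurable_iff_comap_le] at h ⊢
  rw [← MeasurableSpace.comap_comp, ← measurableSpace_distributions_eq_comap] at h
  exact h

theorem pairing_sum {ι : Type*} (β : Distributions k) (s : Finset ι) (c : ι → ℝ)
    (α : ι → TestSpace k) : pairing β (∑ i ∈ s, c i • α i) = ∑ i ∈ s, c i * pairing β (α i) := by
  let l : TestSpace k →L[ℝ] ℝ := β
  change l (∑ i ∈ s, c i • α i) = ∑ i ∈ s, c i * l (α i)
  simp only [map_sum, map_smul, smul_eq_mul]

/-- Both images in the product space of all real functions are projective limits of the same
finite-dimensional marginals. -/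
theorem IsCharFun.unique {μ ν : Measure (Distributions k)} [IsProbabilityMeasure μ]
    [IsProbabilityMeasure ν] {φ : TestSpace k → ℂ} (hμ : IsCharFun μ φ) (hν : IsCharFun ν φ) :
    μ = ν := by
  classical
  have hfin : ∀ J : Finset (TestSpace k),
      (μ.map evalAll).map J.restrict = (ν.map evalAll).map J.restrict := by
    intro J
    have hJ : Measurable (J.restrict ∘ evalAll (k := k)) :=
      (Finset.measurable_restrict J).comp measurable_evalAll
    rw [Measure.map_map (Finset.measurable_restrict J) measurable_evalAll,
      Measure.map_map (Finset.measurable_restrict J) measurable_evalAll]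
    have := Measure.isProbabilityMeasure_map (μ := μ) hJ.aemeasurable
    have := Measure.isProbabilityMeasure_map (μ := ν) hJ.aemeasurable
    refine Measure.ext_of_charFunDual (funext fun l => ?_)
    -- A functional `l` of finitely many pairings is the pairing with one test function, weighted by
    -- the values of `l` on the basis vectors.
    have key : ∀ ρ : Measure (Distributions k), IsCharFun ρ φ →
        charFunDual (ρ.map (J.restrict ∘ evalAll)) l =
          φ (∑ j : J, l (Pi.single j 1) • (j : TestSpace k)) := by
      intro ρ hρ
      rw [charFunDual_apply, integral_map hJ.aemeasurable
        (Continuous.aestronglyMeasurable (by fun_prop)), hρ]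
      refine integral_congr_ae (Filter.Eventually.of_forall fun β => ?_)
      simp only
      rw [mul_comm, pairing_sum]
      congr 3
      have h1 : (J.restrict ∘ evalAll) β = ∑ j : J, pairing β j • (Pi.single j 1 : J → ℝ) := by
        ext i
        simp [Finset.sum_apply, Pi.single_apply, evalAll]
      rw [h1, map_sum]
      simp only [map_smul, smul_eq_mul]
      exact Finset.sum_congr rfl fun j _ => mul_comm _ _
    rw [key μ hμ, key ν hν]
  have hmap : μ.map evalAll = ν.map evalAll := by
    have := Measure.isProbabilityMeasure_map (μ := ν) (measurable_evalAll (k := k)).aemeasurable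
    have : ∀ J : Finset (TestSpace k), IsFiniteMeasure ((ν.map evalAll).map J.restrict) :=
      fun J => inferInstance
    exact IsProjectiveLimit.unique (P := fun J => (ν.map evalAll).map J.restrict) hfin
      fun J => rfl
  ext s hs
  obtain ⟨t, ht, rfl⟩ : MeasurableSet[MeasurableSpace.comap evalAll MeasurableSpace.pi] s := by
    rw [← measurableSpace_distributions_eq_comap]
    exact hs
  rw [← Measure.map_apply measurable_evalAll ht, ← Measure.map_apply measurable_evalAll ht, hmap]

end Cylinder

/-! ### Graph norm and the Hilbert–Schmidt estimate. -/

section GraphNorm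

/-- The Hilbert space of pairs of square integrable functions on the sphere. -/
abbrev L2Pair : Type := WithLp 2 (Lp ℝ 2 sphereMeasure × Lp ℝ 2 sphereMeasure)

instance : Fact ((2 : ENNReal) ≠ ⊤) := ⟨ENNReal.ofNat_ne_top⟩

instance : SecondCountableTopology (Lp ℝ 2 sphereMeasure) := Lp.SecondCountableTopology

/-- The map `α ↦ (α, A α)` into pairs of square integrable functions. -/
def graphMap (k : ℝ) : TestSpace k →ₗ[ℝ] L2Pair :=
  (WithLp.linearEquiv 2 ℝ (Lp ℝ 2 sphereMeasure × Lp ℝ 2 sphereMeasure)).symm.toLinearMap.comp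
    (LinearMap.prod BMS.toL2 (BMS.toL2.comp (opA k)) :
      SmoothFun →ₗ[ℝ] Lp ℝ 2 sphereMeasure × Lp ℝ 2 sphereMeasure)

variable (k : ℝ)

theorem norm_sq_graphMap (α : TestSpace k) :
    ‖graphMap k α‖ ^ 2 = ‖BMS.toL2 α‖ ^ 2 + ‖BMS.toL2 (opA k α)‖ ^ 2 :=
  WithLp.prod_norm_sq_eq_of_L2 _

theorem norm_toL2_le_norm_graphMap (α : TestSpace k) : ‖BMS.toL2 α‖ ≤ ‖graphMap k α‖ := by
  refine le_of_sq_le_sq ?_ (norm_nonneg _)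
  rw [norm_sq_graphMap]
  exact le_add_of_nonneg_right (sq_nonneg _)

theorem norm_toL2_opA_le_norm_graphMap (α : TestSpace k) :
    ‖BMS.toL2 (opA k α)‖ ≤ ‖graphMap k α‖ := by
  refine le_of_sq_le_sq ?_ (norm_nonneg _)
  rw [norm_sq_graphMap]
  exact le_add_of_nonneg_left (sq_nonneg _)

theorem sobolevNorm_zero_apply (α : TestSpace k) : sobolevNorm k 0 α = ‖BMS.toL2 α‖ := by
  simp [sobolevNorm]
  rfl

theorem sobolevNorm_one_apply (α : TestSpace k) : sobolevNorm k 1 α = ‖BMS.toL2 (opA k α)‖ := by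
  simp [sobolevNorm]
  rfl

theorem continuous_graphMap : Continuous (graphMap k) := by
  -- The constant `2` comes from `√(a² + b²) ≤ a + b`, each term being at most the supremum of the
  -- two seminorms.
  refine WithSeminorms.continuous_of_isBounded (withSeminorms_sobolevNorm k)
    (norm_withSeminorms ℝ L2Pair) _ fun _ => ⟨{0, 1}, 2, fun α => ?_⟩
  have h0 : sobolevNorm k 0 α ≤ (({0, 1} : Finset ℕ).sup (sobolevNorm k)) α :=
    Seminorm.le_def.1 (Finset.le_sup (f := sobolevNorm k) (by simp)) α
  have h1 : sobolevNorm k 1 α ≤ (({0, 1} : Finset ℕ).sup (sobolevNorm k)) α :=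
    Seminorm.le_def.1 (Finset.le_sup (f := sobolevNorm k) (by simp)) α
  rw [sobolevNorm_zero_apply] at h0
  rw [sobolevNorm_one_apply] at h1
  change ‖graphMap k α‖ ≤ 2 * (({0, 1} : Finset ℕ).sup (sobolevNorm k)) α
  have h2 := norm_nonneg (BMS.toL2 α)
  have h3 := norm_nonneg (BMS.toL2 (opA k α))
  refine le_of_sq_le_sq ?_ (by linarith)
  rw [norm_sq_graphMap]
  nlinarith

theorem exists_abs_le_norm_graphMap : ∃ C : ℝ, 0 ≤ C ∧ ∀ (α : SmoothFun) (x : S2),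
    |α x| ≤ C * ‖graphMap k α‖ := by
  obtain ⟨C, hC, h⟩ := exists_abs_le_norm_toL2
  refine ⟨C * (2 + |k|), by positivity, fun α x => (h α x).trans ?_⟩
  rw [mul_assoc]
  refine mul_le_mul_of_nonneg_left ?_ hC
  have h1 : sphereLaplacian α = k • α - opA k α := by
    simp [opA]
  have h2 : ‖toL2 (sphereLaplacian α)‖ ≤ |k| * ‖toL2 α‖ + ‖toL2 (opA k α)‖ := by
    rw [h1, map_sub, map_smul]
    refine (norm_sub_le _ _).trans ?_
    rw [norm_smul, Real.norm_eq_abs]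
  have h3 : ‖toL2 α‖ ≤ ‖graphMap k α‖ := norm_toL2_le_norm_graphMap k α
  have h4 : ‖toL2 (opA k α)‖ ≤ ‖graphMap k α‖ := norm_toL2_opA_le_norm_graphMap k α
  nlinarith [abs_nonneg k]

theorem norm_sq_toL2 (α : SmoothFun) : ‖toL2 α‖ ^ 2 = ∫ x, α x ^ 2 ∂sphereMeasure := by
  rw [← real_inner_self_eq_norm_sq, L2.inner_def]
  refine integral_congr_ae ?_
  filter_upwards [ContinuousMap.coeFn_toLp (p := 2) (𝕜 := ℝ) sphereMeasure (toContinuous α)]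
    with x hx
  have hx' : toL2 α x = α x := hx
  rw [hx', real_inner_self_eq_norm_sq, Real.norm_eq_abs, sq_abs]

/-- Bounded point evaluations give a reproducing-kernel bound `∑ αₙ(x)² ≤ C²`; since the sphere has
finite area, it can be integrated. -/
theorem exists_sum_norm_sq_toL2_le : ∃ D : ℝ, ∀ α : ℕ → TestSpace k,
    IsOrthoSeq (fun n => graphMap k (α n)) →
      ∀ N, ∑ n ∈ Finset.range N, ‖TestSpace.toL2 k (α n)‖ ^ 2 ≤ D := by
  obtain ⟨C, hC, hsup⟩ := exists_abs_le_norm_graphMap k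
  refine ⟨∫ _, C ^ 2 ∂sphereMeasure, fun α hα N => ?_⟩
  let a : ℕ → SmoothFun := α
  have hpt : ∀ x : S2, ∑ n ∈ Finset.range N, a n x ^ 2 ≤ C ^ 2 := fun x => by
    set s := ∑ n ∈ Finset.range N, a n x ^ 2 with hs
    have hs0 : 0 ≤ s := Finset.sum_nonneg fun n _ => sq_nonneg _
    -- With `x` frozen, `b x = s`, while orthogonality gives `‖graphMap k b‖² ≤ s`. The pointwise
    -- bound then yields `s² ≤ C² s`.
    let b : SmoothFun := ∑ n ∈ Finset.range N, a n x • a n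
    have h1 := hsup b x
    have h2 : b x = s := by
      have h3 : ∀ F : Finset ℕ, (∑ n ∈ F, a n x • a n) x = ∑ n ∈ F, a n x • a n x := fun F =>
        congrFun (map_sum (ContMDiffMap.coeFnAddMonoidHom) (fun n => a n x • a n) F) x |>.trans
          (by simp [Finset.sum_apply])
      exact (h3 _).trans (Finset.sum_congr rfl fun n _ => (sq _).symm)
    have h4 : graphMap k b =
        ∑ n ∈ Finset.range N, a n x • graphMap k (α n) := by
      have := map_sum (graphMap k) (fun n => a n x • α n) (Finset.range N)
      simp only [map_smul] at this
      exact this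
    rw [h2, h4, abs_of_nonneg hs0] at h1
    have h5 := hα.norm_sq_sum_le (Finset.range N) fun n => a n x
    rw [← hs] at h5
    have h6 : s ^ 2 ≤ C ^ 2 * s := by
      refine (pow_le_pow_left₀ hs0 h1 2).trans ?_
      rw [mul_pow]
      exact mul_le_mul_of_nonneg_left h5 (sq_nonneg C)
    by_contra hlt
    rw [not_le] at hlt
    nlinarith [sq_nonneg C]
  have h7 : ∀ n, Integrable (fun x => a n x ^ 2) sphereMeasure := fun n =>
    (memLp_smoothFun (a n)).integrable_sq
  calc ∑ n ∈ Finset.range N, ‖TestSpace.toL2 k (α n)‖ ^ 2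
      = ∑ n ∈ Finset.range N, ∫ x, a n x ^ 2 ∂sphereMeasure :=
        Finset.sum_congr rfl fun n _ => norm_sq_toL2 (a n)
    _ = ∫ x, ∑ n ∈ Finset.range N, a n x ^ 2 ∂sphereMeasure :=
        (integral_finsetSum _ fun n _ => h7 n).symm
    _ ≤ _ := integral_mono (integrable_finsetSum _ fun n _ => h7 n) (integrable_const _) hpt

/-- The distribution `α ↦ ⟪h, (α, A α)⟫`. -/
def pairDistribution (h : L2Pair) : Distributions k :=
  (innerSL ℝ h).comp ⟨graphMap k, continuous_graphMap k⟩

end GraphNorm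

/-- The measure is the law of the random distribution `α ↦ ⟪X, (α, A α)⟫`. -/
theorem exists_isCharFun_gaussianFunctional (k : ℝ) : ∃ ν : Measure (Distributions k),
    IsProbabilityMeasure ν ∧ IsCharFun ν (gaussianFunctional k) := by
  obtain ⟨D, hD⟩ := exists_sum_norm_sq_toL2_le k
  obtain ⟨X, hX, hchar⟩ := exists_gaussian_vector (graphMap k) (TestSpace.toL2 k) (C := 1)
    (fun β => by rw [one_mul]; exact norm_toL2_le_norm_graphMap k β) hD
  have hT : Measurable fun z => pairDistribution k (X z) := measurable_distributions hX
  refine ⟨stdGaussianSeq.map fun z => pairDistribution k (X z),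
    Measure.isProbabilityMeasure_map hT.aemeasurable, fun α => ?_⟩
  have hα := measurable_pairing α
  rw [integral_map hT.aemeasurable (Measurable.aestronglyMeasurable (by fun_prop))]
  exact (hchar α).symm

end BMS

end

theorem mainTheorem11 (k : ℝ) (hk : 1 < k) :
    ∃! ν : MeasureTheory.Measure (BMS.Distributions k),
      MeasureTheory.IsProbabilityMeasure ν ∧ BMS.IsCharFun ν (BMS.gaussianFunctional k) := by
  obtain ⟨ν, hν, hchar⟩ := BMS.exists_isCharFun_gaussianFunctional k
  refine ⟨ν, ⟨hν, hchar⟩, fun μ hμ => ?_⟩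
  have := hμ.1
  exact hμ.2.unique hchar
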